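/- Let $0<p\le 1$ and let $(M,d)$ be an infinite separable ultrametric space (a metric space with $d(x,z)\le\max\{d(x,y),d(y,z)\}$ for all $x,y,z\in M$) with a distinguished point $0\in M$. Then the Lipschitz free $p$-space $\mathcal F_p(M,d)$ is isomorphic to the real sequence space $\ell_p$, i.e. there is a linear bijection $T\colon\mathcal F_p(M,d)\to\ell_p$ such that $T$ and $T^{-1}$ are bounded. Here a $p$-norm on a real vector space $Y$ is a map $\|\cdot\|_Y\colon Y\to[0,\infty)$ such that $\|y\|_Y>0$ for $y\ne0$, $\|\alpha y\|_Y=|\alpha|\,\|y\|_Y$ for $\alpha\in\mathbb R$, and $\|y+z\|_Y^p\le\|y\|_Y^p+\|z\|_Y^p$. Let $\mathbb R^M_0$ be the vector space of all functions $f\colon M\to\mathbb R$ with $f(0)=0$, and let $\mathcal P(M)$ be the linear span, in the algebraic dual of $\mathbb R^M_0$, of the evaluations $\delta(x)\colon f\mapsto f(x)$, $x\in M$. The space $\mathcal F_p(M,d)$ is the completion of $\mathcal P(M)$ with respect to the $p$-norm $$\Big\|\sum_{j=1}^N a_j\,\delta(x_j)\Big\|_{\mathcal F_p(M,d)}=\sup\Big\|\sum_{j=1}^N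 a_j f(x_j)\Big\|_Y,$$ where the supremum is taken over all $p$-normed spaces $(Y,\|\cdot\|_Y)$ and all maps $f\colon M\to Y$ with $f(0)=0$ and $\|f(x)-f(y)\|_Y\le d(x,y)$ for all $x,y\in M$. -/

import Mathlib

noncomputable section

/-- A `p`-norm on a real vector space: `N x > 0` for `x ≠ 0`, `N (c x) = |c| N x`, and
`N (x + y) ^ p ≤ N x ^ p + N y ^ p`. -/
structure IsPNorm (p : ℝ) {Y : Type*} [AddCommGroup Y] [Module ℝ Y] (N : Y → ℝ) : Prop where
  pos : ∀ x, x ≠ 0 → 0 < N x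
  smul : ∀ (c : ℝ) (x : Y), N (c • x) = |c| * N x
  add : ∀ x y, N (x + y) ^ p ≤ N x ^ p + N y ^ p

/-- Two real vector spaces with quasi-norms `N₁`, `N₂` are isomorphic: there is a linear bijection
which is bounded with bounded inverse. -/
def QuasiNormIsomorphic {X Y : Type*} [AddCommGroup X] [Module ℝ X] [AddCommGroup Y] [Module ℝ Y]
    (N₁ : X → ℝ) (N₂ : Y → ℝ) : Prop :=
  ∃ T : X ≃ₗ[ℝ] Y, ∃ C : ℝ, 0 < C ∧
    (∀ x, N₂ (T x) ≤ C * N₁ x) ∧ (∀ y, N₁ (T.symm y) ≤ C * N₂ y)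

namespace LipFree

universe u

variable {M : Type u}

/-- The space of all real functions on `M` that vanish at the base point `o`. -/
def R0 (o : M) : Submodule ℝ (M → ℝ) where
  carrier := {f | f o = 0}
  add_mem' := by
    intro f g hf hg
    simp only [Set.mem_ofPred_eq] at hf hg
    simp [hf, hg]
  zero_mem' := rfl
  smul_mem' := by
    intro c f hf
    simp only [Set.mem_ofPred_eq] at hf
    simp [hf]

/-- The evaluation functional at `x`, an element of the algebraic dual of `R0 o`. -/
def delta (o x : M) : Module.Dual ℝ (R0 o) where
  toFun f := (f : M → ℝ) x
  map_add' _ _ := rfl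
  map_smul' _ _ := rfl

/-- The linear span of the evaluations. It is a type synonym that carries the exponent `p` and the
distance `ρ`, since its topology depends on them. -/
def PSpan (_p : Set.Ioc (0 : ℝ) 1) (_ρ : M → M → ℝ) (o : M) : Type u :=
  ↥(Submodule.span ℝ (Set.range (delta o)))

variable (p : Set.Ioc (0 : ℝ) 1) (ρ : M → M → ℝ) (o : M)

instance : AddCommGroup (PSpan p ρ o) :=
  inferInstanceAs (AddCommGroup ↥(Submodule.span ℝ (Set.range (delta o))))

instance : Module ℝ (PSpan p ρ o) :=
  inferInstanceAs (Module ℝ ↥(Submodule.span ℝ (Set.range (delta o))))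

/-- The evaluation at `x` as an element of the span. -/
def PSpan.delta (x : M) : PSpan p ρ o :=
  ⟨LipFree.delta o x, Submodule.subset_span ⟨x, rfl⟩⟩

/-- The inclusion of the span into the algebraic dual. -/
def PSpan.incl : PSpan p ρ o →ₗ[ℝ] Module.Dual ℝ (R0 o) :=
  Submodule.subtype (Submodule.span ℝ (Set.range (LipFree.delta o)))

variable {p ρ o}

theorem PSpan.incl_injective : Function.Injective (PSpan.incl p ρ o) :=
  Subtype.val_injective

theorem PSpan.incl_sum (a : M →₀ ℝ) :
    PSpan.incl p ρ o (a.sum fun x c => c • PSpan.delta p ρ o x) =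
      a.sum fun x c => c • LipFree.delta o x := by
  simp only [Finsupp.sum, map_sum, map_smul]
  rfl

theorem sum_smul_smul {Z : Type*} [AddCommGroup Z] [Module ℝ Z] (c : ℝ) (b : M →₀ ℝ) (g : M → Z) :
    ((c • b).sum fun x r => r • g x) = c • b.sum fun x r => r • g x :=
  map_smul (Finsupp.linearCombination ℝ g) c b

theorem sum_add_smul {Z : Type*} [AddCommGroup Z] [Module ℝ Z] (b c : M →₀ ℝ) (g : M → Z) :
    ((b + c).sum fun x r => r • g x) = (b.sum fun x r => r • g x) + c.sum fun x r => r • g x :=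
  map_add (Finsupp.linearCombination ℝ g) b c

/-- All the numbers `‖∑ a_j f(x_j)‖_Y`, where `μ = ∑ a_j δ(x_j)`, `Y` is a `p`-normed space and
`f : M → Y` is `1`-Lipschitz with `f(0) = 0`. The spaces `Y` range over the universe of `M`; this
is no restriction, since `Y` may be replaced by the span of `f(M)`, which is linearly isomorphic to
a quotient of the span of the evaluations. -/
def normSet (μ : PSpan p ρ o) : Set ℝ :=
  {r | ∃ (Y : Type u) (_ : AddCommGroup Y) (_ : Module ℝ Y) (N : Y → ℝ) (f : M → Y),
    IsPNorm (p : ℝ) N ∧ f o = 0 ∧ (∀ x y, N (f x - f y) ≤ ρ x y) ∧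
    ∃ a : M →₀ ℝ, (a.sum fun x c => c • PSpan.delta p ρ o x) = μ ∧
      r = N (a.sum fun x c => c • f x)}

/-- The `p`-seminorm `‖μ‖ = sup ‖∑ a_j f(x_j)‖_Y` on the span of the evaluations. -/
def pnorm (μ : PSpan p ρ o) : ℝ := sSup (normSet μ)

theorem IsPNorm.map_zero' {q : ℝ} {Y : Type*} [AddCommGroup Y] [Module ℝ Y] {N : Y → ℝ}
    (h : IsPNorm q N) : N 0 = 0 := by
  simpa using h.smul 0 0

theorem IsPNorm.nonneg' {q : ℝ} {Y : Type*} [AddCommGroup Y] [Module ℝ Y] {N : Y → ℝ}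
    (h : IsPNorm q N) (x : Y) : 0 ≤ N x := by
  by_cases hx : x = 0
  · rw [hx, IsPNorm.map_zero' h]
  · exact (h.pos x hx).le

theorem exists_rep (μ : PSpan p ρ o) :
    ∃ a : M →₀ ℝ, (a.sum fun x c => c • PSpan.delta p ρ o x) = μ := by
  obtain ⟨a, ha⟩ := (Finsupp.mem_span_range_iff_exists_finsupp).1
    (show PSpan.incl p ρ o μ ∈ Submodule.span ℝ (Set.range (LipFree.delta o)) from Subtype.property _)
  exact ⟨a, PSpan.incl_injective ((PSpan.incl_sum a).trans ha)⟩

theorem rep_zero (a : M →₀ ℝ) (ha : (a.sum fun x c => c • PSpan.delta p ρ o x) = 0)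
    {Y : Type*} [AddCommGroup Y] [Module ℝ Y] (f : M → Y) (hf : f o = 0) :
    (a.sum fun x c => c • f x) = 0 := by
  classical
  have key : ∀ x, x ≠ o → a x = 0 := by
    intro x hx
    have h1 : (a.sum fun x c => c • LipFree.delta o x) = 0 := by
      rw [← PSpan.incl_sum (p := p) (ρ := ρ), ha, map_zero]
    let g : R0 o := ⟨Pi.single x 1, by
      change (Pi.single x (1 : ℝ) : M → ℝ) o = 0
      exact Pi.single_eq_of_ne (Ne.symm hx) _⟩
    have h2 := congrArg (fun L : Module.Dual ℝ (R0 o) => L g) h1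
    simp only [Finsupp.sum, LinearMap.sum_apply, LinearMap.smul_apply, LinearMap.zero_apply] at h2
    have h3 : ∀ y, LipFree.delta o y g = if y = x then 1 else 0 := by
      intro y
      change (Pi.single x (1 : ℝ) : M → ℝ) y = _
      simp [Pi.single_apply]
    simp only [h3, smul_eq_mul, mul_ite, mul_one, mul_zero, Finset.sum_ite_eq'] at h2
    by_contra hne
    rw [if_pos (Finsupp.mem_support_iff.2 hne)] at h2
    exact hne h2
  refine Finset.sum_eq_zero fun x _ => ?_
  by_cases hx : x = o
  · simp [hx, hf]
  · simp [key x hx]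

theorem rep_unique {a b : M →₀ ℝ} (hab : (a.sum fun x c => c • PSpan.delta p ρ o x) =
      b.sum fun x c => c • PSpan.delta p ρ o x)
    {Y : Type*} [AddCommGroup Y] [Module ℝ Y] (f : M → Y) (hf : f o = 0) :
    (a.sum fun x c => c • f x) = b.sum fun x c => c • f x := by
  have h0 : ((a - b).sum fun x c => c • f x) = 0 := by
    refine rep_zero (p := p) (ρ := ρ) (o := o) (a - b) ?_ f hf
    rw [Finsupp.sum_sub_index fun x c d => sub_smul c d _, hab, sub_self]
  rwa [Finsupp.sum_sub_index fun x c d => sub_smul c d _, sub_eq_zero] at h0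

theorem normSet_bddAbove (μ : PSpan p ρ o) : BddAbove (normSet μ) := by
  obtain ⟨b, hb⟩ := exists_rep μ
  have hp := p.2.1
  refine ⟨(∑ x ∈ b.support, (|b x| * ρ x o) ^ (p : ℝ)) ^ (1 / (p : ℝ)), ?_⟩
  rintro r ⟨Y, _, _, N, f, hN, hf0, hf, a, ha, rfl⟩
  rw [rep_unique (p := p) (ρ := ρ) (ha.trans hb.symm) f hf0]
  have h1 : ∀ s : Finset M, N (∑ x ∈ s, b x • f x) ^ (p : ℝ) ≤
      ∑ x ∈ s, (|b x| * ρ x o) ^ (p : ℝ) := by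
    classical
    intro s
    induction s using Finset.induction_on with
    | empty => simp [IsPNorm.map_zero' hN, Real.zero_rpow hp.ne']
    | insert x s hx ih =>
      rw [Finset.sum_insert hx, Finset.sum_insert hx]
      refine (hN.add _ _).trans (add_le_add ?_ ih)
      refine Real.rpow_le_rpow (IsPNorm.nonneg' hN _) ?_ hp.le
      rw [hN.smul]
      have := hf x o
      rw [hf0, sub_zero] at this
      exact mul_le_mul_of_nonneg_left this (abs_nonneg _)
  have h2 := Real.rpow_le_rpow (Real.rpow_nonneg (IsPNorm.nonneg' hN _) _) (h1 b.support)
    (one_div_nonneg.2 hp.le)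
  rwa [← Real.rpow_mul (IsPNorm.nonneg' hN _), mul_one_div_cancel hp.ne', Real.rpow_one] at h2

theorem normSet_nonneg (μ : PSpan p ρ o) {r : ℝ} (hr : r ∈ normSet μ) : 0 ≤ r := by
  obtain ⟨Y, _, _, N, f, hN, -, -, a, -, rfl⟩ := hr
  exact IsPNorm.nonneg' hN _

theorem pnorm_nonneg (μ : PSpan p ρ o) : 0 ≤ pnorm μ :=
  Real.sSup_nonneg fun _ => normSet_nonneg μ

theorem pnorm_add (μ ν : PSpan p ρ o) :
    pnorm (μ + ν) ^ (p : ℝ) ≤ pnorm μ ^ (p : ℝ) + pnorm ν ^ (p : ℝ) := by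
  have hp := p.2.1
  have hnn : 0 ≤ pnorm μ ^ (p : ℝ) + pnorm ν ^ (p : ℝ) :=
    add_nonneg (Real.rpow_nonneg (pnorm_nonneg _) _) (Real.rpow_nonneg (pnorm_nonneg _) _)
  have h : pnorm (μ + ν) ≤ (pnorm μ ^ (p : ℝ) + pnorm ν ^ (p : ℝ)) ^ (1 / (p : ℝ)) := by
    refine Real.sSup_le ?_ (Real.rpow_nonneg hnn _)
    rintro r ⟨Y, i1, i2, N, f, hN, hf0, hf, a, ha, rfl⟩
    obtain ⟨b, hb⟩ := exists_rep μ
    obtain ⟨c, hc⟩ := exists_rep ν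
    have hs : (a.sum fun x c => c • f x) =
        (b.sum fun x c => c • f x) + c.sum fun x c => c • f x := by
      rw [rep_unique (p := p) (ρ := ρ) (b := b + c) _ f hf0]
      · exact sum_add_smul b c f
      · rw [ha, sum_add_smul, hb, hc]
    have hb' : N (b.sum fun x c => c • f x) ≤ pnorm μ :=
      le_csSup (normSet_bddAbove μ) ⟨Y, i1, i2, N, f, hN, hf0, hf, b, hb, rfl⟩
    have hc' : N (c.sum fun x c => c • f x) ≤ pnorm ν :=
      le_csSup (normSet_bddAbove ν) ⟨Y, i1, i2, N, f, hN, hf0, hf, c, hc, rfl⟩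
    have h1 : N (a.sum fun x c => c • f x) ^ (p : ℝ) ≤ pnorm μ ^ (p : ℝ) + pnorm ν ^ (p : ℝ) := by
      rw [hs]
      exact (hN.add _ _).trans (add_le_add
        (Real.rpow_le_rpow (IsPNorm.nonneg' hN _) hb' hp.le)
        (Real.rpow_le_rpow (IsPNorm.nonneg' hN _) hc' hp.le))
    have h2 := Real.rpow_le_rpow (Real.rpow_nonneg (IsPNorm.nonneg' hN _) _) h1
      (one_div_nonneg.2 hp.le)
    rwa [← Real.rpow_mul (IsPNorm.nonneg' hN _), mul_one_div_cancel hp.ne', Real.rpow_one] at h2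
  have h3 := Real.rpow_le_rpow (pnorm_nonneg _) h hp.le
  rwa [← Real.rpow_mul hnn, one_div_mul_cancel hp.ne', Real.rpow_one] at h3

theorem pnorm_smul_le (c : ℝ) (μ : PSpan p ρ o) : pnorm (c • μ) ≤ |c| * pnorm μ := by
  refine Real.sSup_le ?_ (mul_nonneg (abs_nonneg _) (pnorm_nonneg _))
  rintro r ⟨Y, i1, i2, N, f, hN, hf0, hf, a, ha, rfl⟩
  obtain ⟨b, hb⟩ := exists_rep μ
  have hs : (a.sum fun x c => c • f x) = c • b.sum fun x c => c • f x := by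
    rw [rep_unique (p := p) (ρ := ρ) (b := c • b) _ f hf0]
    · exact sum_smul_smul c b f
    · rw [ha, sum_smul_smul, hb]
  rw [hs, hN.smul]
  exact mul_le_mul_of_nonneg_left
    (le_csSup (normSet_bddAbove μ) ⟨Y, i1, i2, N, f, hN, hf0, hf, b, hb, rfl⟩) (abs_nonneg _)

/-- The `p`-th power of the `p`-seminorm is a subadditive function which defines the topology. -/
def powSeminorm : AddGroupSeminorm (PSpan p ρ o) where
  toFun μ := pnorm μ ^ (p : ℝ)
  map_zero' := by
    have h : pnorm (0 : PSpan p ρ o) = 0 := by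
      have := pnorm_smul_le 0 (0 : PSpan p ρ o)
      rw [zero_smul, abs_zero, zero_mul] at this
      exact le_antisymm this (pnorm_nonneg _)
    rw [h, Real.zero_rpow p.2.1.ne']
  add_le' := pnorm_add
  neg' μ := by
    have h : ∀ ν : PSpan p ρ o, pnorm (-ν) ≤ pnorm ν := fun ν => by
      have := pnorm_smul_le (-1) ν
      rwa [neg_one_smul, abs_neg, abs_one, one_mul] at this
    have h' := h (-μ)
    rw [neg_neg] at h'
    rw [le_antisymm (h μ) h']

/-- The translation-invariant pseudometric `‖μ - ν‖ ^ p` on the span of the evaluations. -/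
instance : SeminormedAddCommGroup (PSpan p ρ o) :=
  powSeminorm.toSeminormedAddCommGroup

theorem norm_eq (μ : PSpan p ρ o) : ‖μ‖ = pnorm μ ^ (p : ℝ) := rfl

instance : UniformContinuousConstSMul ℝ (PSpan p ρ o) where
  uniformContinuous_const_smul c := by
    refine (LipschitzWith.of_dist_le_mul (K := (|c| ^ (p : ℝ)).toNNReal) fun μ ν => ?_).uniformContinuous
    rw [dist_eq_norm, dist_eq_norm, ← smul_sub, norm_eq, norm_eq,
      Real.coe_toNNReal _ (Real.rpow_nonneg (abs_nonneg _) _),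
      ← Real.mul_rpow (abs_nonneg _) (pnorm_nonneg _)]
    exact Real.rpow_le_rpow (pnorm_nonneg _) (pnorm_smul_le c _) p.2.1.le

end LipFree

/-- The Lipschitz free `p`-space over a `p`-metric space `(M, ρ)` with base point `o`: the
completion of the span of the evaluations for the metric `‖μ - ν‖ ^ p`. -/
abbrev LipschitzFree {M : Type*} (p : Set.Ioc (0 : ℝ) 1) (ρ : M → M → ℝ) (o : M) : Type _ :=
  UniformSpace.Completion (LipFree.PSpan p ρ o)

/-- The `p`-norm of the Lipschitz free `p`-space. The norm `‖·‖` that the completion carries in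
Mathlib is the `p`-th power of the `p`-norm, hence the exponent `1 / p`. -/
def LipschitzFree.pnorm {M : Type*} {p : Set.Ioc (0 : ℝ) 1} {ρ : M → M → ℝ} {o : M}
    (x : LipschitzFree p ρ o) : ℝ :=
  ‖x‖ ^ (1 / (p : ℝ))

/-- The `p`-norm of the completion extends the `p`-norm of the span of the evaluations. -/
theorem LipschitzFree.pnorm_coe {M : Type*} {p : Set.Ioc (0 : ℝ) 1} {ρ : M → M → ℝ} {o : M}
    (μ : LipFree.PSpan p ρ o) :
    LipschitzFree.pnorm (μ : LipschitzFree p ρ o) = LipFree.pnorm μ := by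
  rw [LipschitzFree.pnorm, UniformSpace.Completion.norm_coe, LipFree.norm_eq,
    ← Real.rpow_mul (LipFree.pnorm_nonneg _), mul_one_div_cancel p.2.1.ne', Real.rpow_one]

theorem LipFree.pnorm_smul {M : Type*} {p : Set.Ioc (0 : ℝ) 1} {ρ : M → M → ℝ} {o : M}
    (c : ℝ) (μ : LipFree.PSpan p ρ o) : LipFree.pnorm (c • μ) = |c| * LipFree.pnorm μ := by
  refine le_antisymm (LipFree.pnorm_smul_le c μ) ?_
  rcases eq_or_ne c 0 with rfl | hc
  · simpa using LipFree.pnorm_nonneg _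
  · have h := LipFree.pnorm_smul_le c⁻¹ (c • μ)
    rw [inv_smul_smul₀ hc, abs_inv] at h
    have hc' : 0 < |c| := abs_pos.2 hc
    calc |c| * LipFree.pnorm μ ≤ |c| * (|c|⁻¹ * LipFree.pnorm (c • μ)) := by gcongr
      _ = _ := by field_simp

/-- The Lipschitz free `p`-space is a `p`-Banach space: it is complete by construction, and its
`p`-norm is a `p`-norm. -/
theorem LipschitzFree.isPNorm {M : Type*} {p : Set.Ioc (0 : ℝ) 1} {ρ : M → M → ℝ} {o : M} :
    IsPNorm (p : ℝ) (LipschitzFree.pnorm : LipschitzFree p ρ o → ℝ) where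
  pos x hx := Real.rpow_pos_of_pos (norm_pos_iff.2 hx) _
  smul c x := by
    refine UniformSpace.Completion.induction_on x ?_ fun μ => ?_
    · have hcont : Continuous (LipschitzFree.pnorm : LipschitzFree p ρ o → ℝ) :=
        continuous_norm.rpow_const fun _ => Or.inr (one_div_nonneg.2 p.2.1.le)
      exact isClosed_eq (hcont.comp (continuous_const_smul c)) (continuous_const.mul hcont)
    · rw [← UniformSpace.Completion.coe_smul, LipschitzFree.pnorm_coe, LipschitzFree.pnorm_coe,
        LipFree.pnorm_smul]
  add x y := by
    have h : ∀ z : LipschitzFree p ρ o, LipschitzFree.pnorm z ^ (p : ℝ) = ‖z‖ := fun z => by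
      rw [LipschitzFree.pnorm, ← Real.rpow_mul (norm_nonneg _), one_div_mul_cancel p.2.1.ne',
        Real.rpow_one]
    rw [h, h, h]
    exact norm_add_le x y

end

/-!
Enumerate a dense sequence of distinct points `x 0 = o, x 1, …` and join every `x (n + 1)` to the
nearest preceding term, the earliest one in case of a tie. In an ultrametric space the terms above
an edge are those in the ball around `x (n + 1)` of radius `gap n`, the length of the edge, so the
normalized molecules of the edges are biorthogonal to the functions `gap n` on these balls. The
balls that contain a given point have distinct radii; after all distances are rounded up to powers
of `2`, the `p`-th powers of the radii below `d(y, z)` form a geometric series with sum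
`O(d(y, z) ^ p)`. Therefore the functions together form a Lipschitz map into `ℓ_p`, and its
extension to the free space inverts the operator that sends the unit vectors to the molecules.
-/

section LpBiorthogonal

open UniformSpace Topology
open scoped ENNReal

section Completion

variable {E : Type*} [SeminormedAddCommGroup E] [Module ℝ E] [UniformContinuousConstSMul ℝ E]

theorem extend_toComplL_coe (f : E →L[ℝ] ℝ) (y : E) :
    f.extend Completion.toComplL (y : Completion E) = f y :=
  f.extend_eq (e := Completion.toComplL) Completion.denseRange_coe
    (Completion.isUniformInducing_coe E) y

theorem dense_span_range_coe {ι : Type*} {m : ι → E}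
    (hd : Dense (Submodule.span ℝ (Set.range m) : Set E)) :
    Dense (Submodule.span ℝ (Set.range fun n => (m n : Completion E)) : Set (Completion E)) := by
  have himage := Completion.denseRange_coe.dense_image (Completion.continuous_coe E) hd
  have hmap :=
    Submodule.map_span (Completion.toComplL : E →L[ℝ] Completion E).toLinearMap (Set.range m)
  rw [← Set.range_comp] at hmap
  exact congrArg ((↑) : _ → Set (Completion E)) hmap ▸ himage

end Completion

/-- A biorthogonal system `(m, φ)` in a space with a `p`-homogeneous norm (the `p`-th power of a
`p`-norm), with the two estimates that make it equivalent to the unit vectors of `ℓ_p`: the vectors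
are bounded, and the coordinate functionals map the space boundedly into `ℓ_p`. The homogeneity of
the norm enters only along the vectors `m n`. -/
structure IsLpBiorthogonal {ι E : Type*} [SeminormedAddCommGroup E] [Module ℝ E] (p K : ℝ)
    (m : ι → E) (φ : ι → E →L[ℝ] ℝ) : Prop where
  norm_smul_le : ∀ n (t : ℝ), ‖t • m n‖ ≤ K * ‖t‖ ^ p
  apply_self : ∀ n, φ n (m n) = 1
  apply_of_ne : ∀ {n k}, k ≠ n → φ n (m k) = 0
  sum_le : ∀ y (s : Finset ι), ∑ n ∈ s, ‖φ n y‖ ^ p ≤ K * ‖y‖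

theorem continuous_of_norm_rpow_le {E : Type*} [SeminormedAddCommGroup E] [Module ℝ E]
    {p K : ℝ} (hp : 0 < p) (φ : E →ₗ[ℝ] ℝ) (h : ∀ y, ‖φ y‖ ^ p ≤ K * ‖y‖) : Continuous φ := by
  refine continuous_of_continuousAt_zero φ.toAddMonoidHom ?_
  have hbound : ∀ y, ‖φ y‖ ≤ (K * ‖y‖) ^ p⁻¹ := fun y =>
    (Real.le_rpow_inv_iff_of_pos (norm_nonneg _)
      ((Real.rpow_nonneg (norm_nonneg _) _).trans (h y)) hp).2 (h y)
  have hlim : Filter.Tendsto (fun y : E => (K * ‖y‖) ^ p⁻¹) (𝓝 0) (𝓝 0) := by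
    have hcont : Continuous fun y : E => (K * ‖y‖) ^ p⁻¹ :=
      (continuous_const.mul continuous_norm).rpow_const fun _ => Or.inr (inv_nonneg.2 hp.le)
    simpa [Real.zero_rpow (inv_ne_zero hp.ne')] using hcont.tendsto 0
  simpa [ContinuousAt] using squeeze_zero_norm hbound hlim

namespace IsLpBiorthogonal

theorem pos {ι E : Type*} [SeminormedAddCommGroup E] [Module ℝ E] {p K : ℝ} {m : ι → E}
    {φ : ι → E →L[ℝ] ℝ} [Nonempty ι] (h : IsLpBiorthogonal p K m φ) : 0 < K := by
  obtain ⟨n⟩ := ‹Nonempty ι›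
  have hle : 1 ≤ K * ‖m n‖ := by simpa [h.apply_self] using h.sum_le (m n) {n}
  exact pos_of_mul_pos_left (one_pos.trans_le hle) (norm_nonneg _)

section Completion

variable {ι E : Type*} [SeminormedAddCommGroup E] [Module ℝ E] [UniformContinuousConstSMul ℝ E]
  {p K : ℝ} {m : ι → E} {φ : ι → E →L[ℝ] ℝ}

theorem completion (hp : 0 ≤ p) (h : IsLpBiorthogonal p K m φ) :
    IsLpBiorthogonal p K (fun n => (m n : Completion E))
      (fun n => (φ n).extend Completion.toComplL) where
  norm_smul_le n t := by
    rw [← Completion.coe_smul, Completion.norm_coe]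
    exact h.norm_smul_le n t
  apply_self n := (extend_toComplL_coe _ _).trans (h.apply_self n)
  apply_of_ne hkn := (extend_toComplL_coe _ _).trans (h.apply_of_ne hkn)
  sum_le y s := by
    induction y using Completion.induction_on with
    | hp =>
      refine isClosed_le (continuous_finsetSum _ fun n _ => ?_)
        (continuous_const.mul continuous_norm)
      exact (ContinuousLinearMap.continuous _).norm.rpow_const fun _ => Or.inr hp
    | ih y =>
      simp only [extend_toComplL_coe, Completion.norm_coe]
      exact h.sum_le y s

end Completion

section Complete

variable {ι E : Type*} [NormedAddCommGroup E] [Module ℝ E] {p : ℝ≥0∞} {K : ℝ} {m : ι → E}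
  {φ : ι → E →L[ℝ] ℝ}

theorem memℓp_coords (h : IsLpBiorthogonal p.toReal K m φ) (y : E) :
    Memℓp (fun n => φ n y) p :=
  memℓp_gen' (h.sum_le y)

/-- The coordinate map of an `ℓ_p`-biorthogonal system. -/
def coords (h : IsLpBiorthogonal p.toReal K m φ) : E →ₗ[ℝ] lp (fun _ : ι => ℝ) p where
  toFun y := ⟨fun n => φ n y, h.memℓp_coords y⟩
  map_add' y z := by ext n; exact map_add (φ n) y z
  map_smul' t y := by ext n; exact map_smul (φ n) t y

theorem norm_coords_rpow_le (hp : 0 < p.toReal) (h : IsLpBiorthogonal p.toReal K m φ) (y : E) :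
    ‖h.coords y‖ ^ p.toReal ≤ K * ‖y‖ := by
  rw [lp.norm_rpow_eq_tsum hp]
  exact Real.tsum_le_of_sum_le (fun n => by positivity) (h.sum_le y)

variable [CompleteSpace E]

theorem summable_smul (hp : 0 < p.toReal) (h : IsLpBiorthogonal p.toReal K m φ)
    (a : lp (fun _ : ι => ℝ) p) : Summable fun n => a n • m n :=
  Summable.of_norm_bounded ((lp.hasSum_norm hp a).summable.mul_left K)
    fun n => h.norm_smul_le n (a n)

variable [ContinuousConstSMul ℝ E]

/-- The map `a ↦ ∑ a_n m_n` of an `ℓ_p`-biorthogonal system. -/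
noncomputable def combination (hp : 0 < p.toReal) (h : IsLpBiorthogonal p.toReal K m φ) :
    lp (fun _ : ι => ℝ) p →ₗ[ℝ] E where
  toFun a := ∑' n, a n • m n
  map_add' a b := by
    rw [← (h.summable_smul hp a).tsum_add (h.summable_smul hp b)]
    simp only [lp.coeFn_add, Pi.add_apply, add_smul]
  map_smul' t a := by
    rw [RingHom.id_apply, ← (h.summable_smul hp a).tsum_const_smul t]
    simp only [lp.coeFn_smul, Pi.smul_apply, smul_assoc]

theorem norm_combination_le (hp : 0 < p.toReal) (h : IsLpBiorthogonal p.toReal K m φ)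
    (a : lp (fun _ : ι => ℝ) p) : ‖h.combination hp a‖ ≤ K * ‖a‖ ^ p.toReal :=
  tsum_of_norm_bounded ((lp.hasSum_norm hp a).mul_left K) fun n => h.norm_smul_le n (a n)

theorem coords_combination (hp : 0 < p.toReal) (h : IsLpBiorthogonal p.toReal K m φ)
    (a : lp (fun _ : ι => ℝ) p) : h.coords (h.combination hp a) = a := by
  ext n
  have hsum : HasSum (fun k => φ n (a k • m k)) (φ n (h.combination hp a)) :=
    (φ n).hasSum (h.summable_smul hp a).hasSum
  refine hsum.unique ?_
  convert hasSum_single n fun k hk => ?_ using 1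
  · rw [map_smul, h.apply_self, smul_eq_mul, mul_one]
  · rw [map_smul, h.apply_of_ne hk, smul_zero]

theorem combination_coords_basis (hp : 0 < p.toReal) (h : IsLpBiorthogonal p.toReal K m φ)
    (k : ι) : h.combination hp (h.coords (m k)) = m k := by
  change ∑' n, φ n (m k) • m n = m k
  rw [tsum_eq_single k fun n hn => by rw [h.apply_of_ne hn.symm, zero_smul], h.apply_self,
    one_smul]

variable [Nonempty ι]

theorem continuous_combination_coords (hp : 0 < p.toReal) (h : IsLpBiorthogonal p.toReal K m φ) :
    Continuous (h.combination hp ∘ₗ h.coords) :=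
  AddMonoidHomClass.continuous_of_bound _ (K * K) fun y =>
    calc ‖h.combination hp (h.coords y)‖
        ≤ K * ‖h.coords y‖ ^ p.toReal := h.norm_combination_le hp _
      _ ≤ K * (K * ‖y‖) := mul_le_mul_of_nonneg_left (h.norm_coords_rpow_le hp y) h.pos.le
      _ = K * K * ‖y‖ := (mul_assoc _ _ _).symm

theorem combination_coords (hp : 0 < p.toReal) (h : IsLpBiorthogonal p.toReal K m φ)
    (hd : Dense (Submodule.span ℝ (Set.range m) : Set E)) (y : E) :
    h.combination hp (h.coords y) = y := by
  have hspan : Set.EqOn (h.combination hp ∘ₗ h.coords) LinearMap.id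
      (Submodule.span ℝ (Set.range m)) :=
    LinearMap.eqOn_span' <| by
      rintro _ ⟨k, rfl⟩
      exact h.combination_coords_basis hp k
  exact congrFun ((h.continuous_combination_coords hp).ext_on hd continuous_id hspan) y

theorem quasiNormIsomorphic (hp : 0 < p.toReal) (h : IsLpBiorthogonal p.toReal K m φ)
    (hd : Dense (Submodule.span ℝ (Set.range m) : Set E)) :
    QuasiNormIsomorphic (fun y : E => ‖y‖ ^ (1 / p.toReal))
      (fun a : lp (fun _ : ι => ℝ) p => ‖a‖) := by
  have hK := h.pos
  refine ⟨LinearEquiv.ofLinearMap h.coords (h.combination hp)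
    (LinearMap.ext (h.coords_combination hp)) (LinearMap.ext (h.combination_coords hp hd)),
    K ^ (1 / p.toReal), by positivity, fun y => ?_, fun a => ?_⟩
  · change ‖h.coords y‖ ≤ _
    rw [← Real.mul_rpow hK.le (norm_nonneg y), one_div,
      Real.le_rpow_inv_iff_of_pos (lp.norm_nonneg' _) (by positivity) hp]
    exact h.norm_coords_rpow_le hp y
  · calc ‖h.combination hp a‖ ^ (1 / p.toReal)
        ≤ (K * ‖a‖ ^ p.toReal) ^ (1 / p.toReal) := by
          gcongr
          exact h.norm_combination_le hp a
      _ = K ^ (1 / p.toReal) * ‖a‖ := by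
          have ha := lp.norm_nonneg' a
          rw [Real.mul_rpow hK.le (by positivity), one_div,
            Real.rpow_rpow_inv ha hp.ne']

end Complete
end IsLpBiorthogonal
end LpBiorthogonal

namespace LipFree

universe u

section PSpan

variable {M : Type u} {p : Set.Ioc (0 : ℝ) 1} {ρ : M → M → ℝ} {o : M}

theorem norm_smul_eq (c : ℝ) (μ : PSpan p ρ o) : ‖c • μ‖ = ‖c‖ ^ (p : ℝ) * ‖μ‖ := by
  rw [norm_eq, norm_eq, pnorm_smul, Real.mul_rpow (abs_nonneg c) (pnorm_nonneg μ),
    Real.norm_eq_abs]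

theorem PSpan.delta_base : PSpan.delta p ρ o o = 0 :=
  incl_injective (LinearMap.ext fun g => g.2)

theorem PSpan.span_range_delta : Submodule.span ℝ (Set.range (PSpan.delta p ρ o)) = ⊤ :=
  eq_top_iff.2 fun μ _ => Finsupp.mem_span_range_iff_exists_finsupp.2 (exists_rep μ)

theorem pnorm_delta_sub_le {x y : M} (h : 0 ≤ ρ x y) :
    pnorm (PSpan.delta p ρ o x - PSpan.delta p ρ o y) ≤ ρ x y := by
  refine Real.sSup_le ?_ h
  rintro r ⟨Y, _, _, N, f, -, hf0, hf, a, ha, rfl⟩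
  have hsub {Z : Type u} [AddCommGroup Z] [Module ℝ Z] (g : M → Z) :
      ((Finsupp.single x 1 - Finsupp.single y 1 : M →₀ ℝ).sum fun z c => c • g z) =
        g x - g y := by
    rw [Finsupp.sum_sub_index fun z c d => sub_smul c d (g z)]
    simp
  rw [rep_unique (p := p) (ρ := ρ) (ha.trans (hsub _).symm) f hf0, hsub]
  exact hf x y

theorem norm_delta_sub_le {x y : M} (h : 0 ≤ ρ x y) :
    ‖PSpan.delta p ρ o x - PSpan.delta p ρ o y‖ ≤ ρ x y ^ (p : ℝ) :=
  Real.rpow_le_rpow (pnorm_nonneg _) (pnorm_delta_sub_le h) p.2.1.le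

theorem le_mul_pnorm {Y : Type u} [AddCommGroup Y] [Module ℝ Y] {N : Y → ℝ}
    (hN : IsPNorm (p : ℝ) N) {L : ℝ} (hL : 0 < L) (Φ : PSpan p ρ o →ₗ[ℝ] Y)
    (hΦ : ∀ x y, N (Φ (PSpan.delta p ρ o x) - Φ (PSpan.delta p ρ o y)) ≤ L * ρ x y)
    (μ : PSpan p ρ o) : N (Φ μ) ≤ L * pnorm μ := by
  obtain ⟨a, rfl⟩ := exists_rep μ
  have hscale (y : Y) : N (L⁻¹ • y) = L⁻¹ * N y := by rw [hN.smul, abs_of_pos (inv_pos.2 hL)]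
  let f : M → Y := fun x => L⁻¹ • Φ (PSpan.delta p ρ o x)
  have hf0 : f o = 0 := by simp only [f, PSpan.delta_base, map_zero, smul_zero]
  have hf (x y : M) : N (f x - f y) ≤ ρ x y := by
    rw [← smul_sub, hscale, inv_mul_le_iff₀ hL]
    exact hΦ x y
  have hsum : (a.sum fun x c => c • f x) =
      L⁻¹ • Φ (a.sum fun x c => c • PSpan.delta p ρ o x) := by
    rw [← LinearMap.smul_apply, map_finsuppSum]
    simp only [map_smul, LinearMap.smul_apply, f]
  rw [← inv_mul_le_iff₀ hL, ← hscale, ← hsum]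
  exact le_csSup (normSet_bddAbove _) ⟨Y, _, _, N, f, hN, hf0, hf, a, rfl, rfl⟩

/-- The evaluation of the elements of the span at a function that vanishes at the base point. -/
def PSpan.eval (g : R0 o) : PSpan p ρ o →ₗ[ℝ] ℝ :=
  LinearMap.applyₗ g ∘ₗ PSpan.incl p ρ o

theorem PSpan.eval_delta (g : R0 o) (x : M) :
    PSpan.eval g (PSpan.delta p ρ o x) = (g : M → ℝ) x := rfl

end PSpan

section FiniteLp

variable {p : ℝ} {ι : Type*} [Fintype ι]

theorem isPNorm_sum_rpow (hp : 0 < p) (hp1 : p ≤ 1) :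
    IsPNorm p (fun v : ι → ℝ => (∑ i, |v i| ^ p) ^ p⁻¹) where
  pos v hv := by
    obtain ⟨i, hi⟩ := Function.ne_iff.1 hv
    have : 0 < |v i| := abs_pos.2 hi
    exact Real.rpow_pos_of_pos (Finset.sum_pos' (fun j _ => by positivity)
      ⟨i, Finset.mem_univ i, by positivity⟩) _
  smul c v := by
    simp only [Pi.smul_apply, smul_eq_mul, abs_mul, Real.mul_rpow (abs_nonneg _) (abs_nonneg _),
      ← Finset.mul_sum]
    rw [Real.mul_rpow (by positivity) (by positivity), Real.rpow_rpow_inv (abs_nonneg c) hp.ne']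
  add v w := by
    have hpow (u : ι → ℝ) : ((∑ i, |u i| ^ p) ^ p⁻¹) ^ p = ∑ i, |u i| ^ p :=
      Real.rpow_inv_rpow (by positivity) hp.ne'
    rw [hpow, hpow, hpow, ← Finset.sum_add_distrib]
    gcongr with i
    calc |v i + w i| ^ p ≤ (|v i| + |w i|) ^ p := by
          gcongr
          exact abs_add_le _ _
      _ ≤ |v i| ^ p + |w i| ^ p :=
          Real.rpow_add_le_add_rpow (abs_nonneg _) (abs_nonneg _) hp.le hp1

end FiniteLp

section Lipschitz

variable {M : Type u} {p : Set.Ioc (0 : ℝ) 1} {ρ : M → M → ℝ} {o : M}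

theorem sum_eval_rpow_le {ι : Type*} (g : ι → R0 o) (s : Finset ι) {K : ℝ} (hK : 0 < K)
    (hρ : ∀ x y, 0 ≤ ρ x y)
    (hg : ∀ x y, ∑ n ∈ s, |(g n : M → ℝ) x - (g n : M → ℝ) y| ^ (p : ℝ) ≤ K * ρ x y ^ (p : ℝ))
    (μ : PSpan p ρ o) : ∑ n ∈ s, ‖PSpan.eval (g n) μ‖ ^ (p : ℝ) ≤ K * ‖μ‖ := by
  have hp := p.2.1
  -- `Fin` is lifted because the target spaces in `normSet` live in the universe of `M`.
  let e : ULift.{u} (Fin s.card) ≃ s := Equiv.ulift.trans s.equivFin.symm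
  have hsum (F : ι → ℝ) : ∑ i, F (e i) = ∑ n ∈ s, F n :=
    (e.sum_comp fun n : s => F n).trans (Finset.sum_coe_sort s F)
  let Φ : PSpan p ρ o →ₗ[ℝ] (ULift.{u} (Fin s.card) → ℝ) :=
    LinearMap.pi fun i => PSpan.eval (g (e i))
  have hroot {t : ℝ} (ht : 0 ≤ t) : (K * t ^ (p : ℝ)) ^ (p : ℝ)⁻¹ = K ^ (p : ℝ)⁻¹ * t := by
    rw [Real.mul_rpow hK.le (by positivity), Real.rpow_rpow_inv ht hp.ne']
  have hbound := le_mul_pnorm (isPNorm_sum_rpow hp p.2.2) (L := K ^ (p : ℝ)⁻¹) (by positivity) Φ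
    (fun x y => by
      rw [← hroot (hρ x y)]
      gcongr
      exact (hsum fun n => |(g n : M → ℝ) x - (g n : M → ℝ) y| ^ (p : ℝ)).trans_le (hg x y)) μ
  rw [← hroot (pnorm_nonneg μ), ← norm_eq,
    Real.rpow_le_rpow_iff (by positivity) (by positivity) (by positivity)] at hbound
  exact (hsum fun n => ‖PSpan.eval (g n) μ‖ ^ (p : ℝ)).symm.trans_le hbound

end Lipschitz
end LipFree

theorem sum_zpow_le {q : ℝ} (hq : 1 < q) {k : ℤ} (t : Finset ℤ) (ht : ∀ e ∈ t, e ≤ k) :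
    ∑ e ∈ t, q ^ e ≤ (1 - q⁻¹)⁻¹ * q ^ k := by
  have hq0 : 0 < q := one_pos.trans hq
  have hterm : ∀ e ∈ t, q ^ e = q⁻¹ ^ (k - e).toNat * q ^ k := fun e he => by
    rw [← zpow_natCast, Int.toNat_of_nonneg (sub_nonneg.2 (ht e he)), inv_zpow',
      ← zpow_add₀ hq0.ne']
    congr 1
    ring
  have hinj : Set.InjOn (fun e => (k - e).toNat) (t : Set ℤ) := fun e he e' he' h => by
    have := ht e he
    have := ht e' he'
    simp only at h
    omega
  rw [Finset.sum_congr rfl hterm, ← Finset.sum_mul,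
    ← Finset.sum_image (f := fun j : ℕ => q⁻¹ ^ j) hinj,
    ← tsum_geometric_of_lt_one (by positivity) (inv_lt_one_of_one_lt₀ hq)]
  gcongr
  exact (summable_geometric_of_lt_one (by positivity) (inv_lt_one_of_one_lt₀ hq)).sum_le_tsum _
    fun j _ => by positivity

namespace NearestNeighborTree

variable {M : Type*} [MetricSpace M] {x : ℕ → M}

/-- The earliest of the terms `x 0, …, x n` nearest to `x (n + 1)`. Joining every `x (n + 1)` to
its parent turns the sequence `x` into a tree rooted at `x 0`. -/
noncomputable def parent (x : ℕ → M) (n : ℕ) : ℕ :=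
  sInf {j | j ≤ n ∧ ∀ k ≤ n, dist (x (n + 1)) (x j) ≤ dist (x (n + 1)) (x k)}

/-- The distance of `x (n + 1)` to the set of the preceding terms. -/
noncomputable def gap (x : ℕ → M) (n : ℕ) : ℝ :=
  dist (x (n + 1)) (x (parent x n))

/-- The functional dual to the edge joining `x (n + 1)` to its parent: a function with the value
`gap x n` on the branch above this edge, which is a ball, and zero elsewhere. -/
noncomputable def bump (x : ℕ → M) (n : ℕ) : M → ℝ :=
  (Metric.ball (x (n + 1)) (gap x n)).indicator fun _ => gap x n

theorem parent_mem (x : ℕ → M) (n : ℕ) :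
    parent x n ∈ {j | j ≤ n ∧ ∀ k ≤ n, dist (x (n + 1)) (x j) ≤ dist (x (n + 1)) (x k)} := by
  refine Nat.sInf_mem ?_
  obtain ⟨j, hj, hmin⟩ := Finset.exists_min_image (Finset.Iic n)
    (fun k => dist (x (n + 1)) (x k)) ⟨n, Finset.mem_Iic.2 le_rfl⟩
  exact ⟨j, Finset.mem_Iic.1 hj, fun k hk => hmin k (Finset.mem_Iic.2 hk)⟩

theorem parent_le (x : ℕ → M) (n : ℕ) : parent x n ≤ n :=
  (parent_mem x n).1

theorem gap_le {n k : ℕ} (hk : k ≤ n) : gap x n ≤ dist (x (n + 1)) (x k) :=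
  (parent_mem x n).2 k hk

theorem gap_lt {n k : ℕ} (hk : k < parent x n) : gap x n < dist (x (n + 1)) (x k) := by
  by_contra! hle
  exact Nat.notMem_of_lt_sInf hk
    ⟨hk.le.trans (parent_le x n), fun i hi => hle.trans (gap_le hi)⟩

theorem gap_pos (hx : Function.Injective x) (n : ℕ) : 0 < gap x n :=
  dist_pos.2 (hx.ne (Nat.lt_succ_of_le (parent_le x n)).ne')

theorem lt_of_mem_ball {n k : ℕ} (h : x k ∈ Metric.ball (x (n + 1)) (gap x n)) : n < k := by
  by_contra! hk
  exact (gap_le hk).not_gt (Metric.mem_ball'.1 h)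

theorem bump_zero (x : ℕ → M) (n : ℕ) : bump x n (x 0) = 0 :=
  Set.indicator_of_notMem (fun h => n.not_lt_zero (lt_of_mem_ball h)) _

variable [IsUltrametricDist M]

theorem mem_ball_iff_of_dist_lt {c y z : M} {r : ℝ} (h : dist y z < r) :
    y ∈ Metric.ball c r ↔ z ∈ Metric.ball c r := by
  rw [Metric.mem_ball_comm, Metric.mem_ball_comm (x := z),
    IsUltrametricDist.ball_eq_of_mem (Metric.mem_ball'.2 h)]

theorem gap_lt_gap {y : M} {n n' : ℕ} (hn : y ∈ Metric.ball (x (n + 1)) (gap x n))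
    (hn' : y ∈ Metric.ball (x (n' + 1)) (gap x n')) (hlt : n < n') : gap x n' < gap x n := by
  have hdist : gap x n' ≤ dist (x (n' + 1)) (x (n + 1)) := gap_le hlt
  rcases le_max_iff.1 (hdist.trans (dist_triangle_max _ y _)) with h | h
  · exact absurd (Metric.mem_ball'.1 hn') h.not_gt
  · exact h.trans_lt hn

theorem injOn_gap (x : ℕ → M) (y : M) :
    Set.InjOn (gap x) {n | y ∈ Metric.ball (x (n + 1)) (gap x n)} := by
  intro n hn n' hn' heq
  rcases lt_trichotomy n n' with hlt | rfl | hlt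
  · exact absurd heq (gap_lt_gap hn hn' hlt).ne'
  · rfl
  · exact absurd heq (gap_lt_gap hn' hn hlt).ne

theorem mem_ball_parent_iff {j n : ℕ} (hne : n ≠ j) :
    x (parent x j) ∈ Metric.ball (x (n + 1)) (gap x n) ↔
      x (j + 1) ∈ Metric.ball (x (n + 1)) (gap x n) := by
  refine ⟨fun h => ?_, fun h => ?_⟩
  · have hearly : gap x j < dist (x (j + 1)) (x (parent x n)) :=
      gap_lt ((parent_le x n).trans_lt (lt_of_mem_ball h))
    have hdist : dist (x (parent x j)) (x (parent x n)) ≤ gap x n :=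
      (dist_triangle_max _ (x (n + 1)) _).trans (max_le h.le le_rfl)
    have hgap : gap x j < gap x n := by
      rcases lt_max_iff.1 (hearly.trans_le (dist_triangle_max _ (x (parent x j)) _)) with h' | h'
      · exact absurd h' (lt_irrefl _)
      · exact h'.trans_le hdist
    exact (mem_ball_iff_of_dist_lt hgap).2 h
  · have hlt : n < j := lt_of_le_of_ne (Nat.lt_succ_iff.1 (lt_of_mem_ball h)) hne
    have hgap : gap x j < gap x n := (gap_le hlt).trans_lt h
    exact (mem_ball_iff_of_dist_lt hgap).1 h

theorem bump_succ_sub_bump_parent (hx : Function.Injective x) (j n : ℕ) :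
    bump x n (x (j + 1)) - bump x n (x (parent x j)) = if j = n then gap x n else 0 := by
  split_ifs with hjn
  · subst hjn
    have hparent : x (parent x j) ∉ Metric.ball (x (j + 1)) (gap x j) := fun h =>
      (parent_le x j).not_gt (lt_of_mem_ball h)
    rw [bump, Set.indicator_of_mem (Metric.mem_ball_self (gap_pos hx j)),
      Set.indicator_of_notMem hparent, sub_zero]
  · classical
    simp only [bump, Set.indicator_apply, mem_ball_parent_iff (Ne.symm hjn), sub_self]

section Dyadic

variable (hdy : ∀ y z : M, y ≠ z → ∃ k : ℤ, dist y z = 2 ^ k) {p : ℝ}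
include hdy

theorem sum_gap_rpow_le (hx : Function.Injective x) (hp : 0 < p) {y z w : M} (hyz : y ≠ z)
    (s : Finset ℕ) (hw : ∀ n ∈ s, w ∈ Metric.ball (x (n + 1)) (gap x n))
    (hs : ∀ n ∈ s, gap x n ≤ dist y z) :
    ∑ n ∈ s, gap x n ^ p ≤ (1 - ((2 : ℝ) ^ p)⁻¹)⁻¹ * dist y z ^ p := by
  obtain ⟨k, hk⟩ := hdy y z hyz
  have hpow (e : ℤ) : ((2 : ℝ) ^ e) ^ p = ((2 : ℝ) ^ p) ^ e := by
    rw [← Real.rpow_intCast_mul zero_le_two, mul_comm, Real.rpow_mul_intCast zero_le_two]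
  choose e he using fun n => hdy _ _ (dist_pos.1 (gap_pos hx n))
  have hgap (n : ℕ) : gap x n = 2 ^ e n := he n
  have hinj : Set.InjOn e s := fun n hn n' hn' h =>
    injOn_gap x w (hw n hn) (hw n' hn') (by rw [hgap, hgap, h])
  simp only [hk, hgap, hpow]
  rw [← Finset.sum_image (f := fun i : ℤ => ((2 : ℝ) ^ p) ^ i) hinj]
  refine sum_zpow_le (Real.one_lt_rpow one_lt_two hp) _ (Finset.forall_mem_image.2 fun n hn => ?_)
  have hle := hs n hn
  rwa [hk, hgap, zpow_le_zpow_iff_right₀ one_lt_two] at hle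

theorem sum_bump_sub_rpow_le (hx : Function.Injective x) (hp : 0 < p) (s : Finset ℕ) (y z : M) :
    ∑ n ∈ s, |bump x n y - bump x n z| ^ p ≤
      2 * (1 - ((2 : ℝ) ^ p)⁻¹)⁻¹ * dist y z ^ p := by
  classical
  rcases eq_or_ne y z with rfl | hyz
  · simp [Real.zero_rpow hp.ne']
  let ballGap (w : M) (n : ℕ) : ℝ :=
    if w ∈ Metric.ball (x (n + 1)) (gap x n) ∧ gap x n ≤ dist y z then gap x n ^ p else 0
  have hterm (n : ℕ) : |bump x n y - bump x n z| ^ p ≤ ballGap y n + ballGap z n := by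
    have hpow : 0 ≤ gap x n ^ p := Real.rpow_nonneg (gap_pos hx n).le p
    rcases lt_or_ge (dist y z) (gap x n) with hlt | hle
    · simp only [bump, Set.indicator_apply, mem_ball_iff_of_dist_lt hlt, sub_self, abs_zero,
        Real.zero_rpow hp.ne', ballGap, hlt.not_ge, and_false, if_false, add_zero, le_refl]
    · by_cases hy : y ∈ Metric.ball (x (n + 1)) (gap x n) <;>
        by_cases hz : z ∈ Metric.ball (x (n + 1)) (gap x n) <;>
        simp [bump, ballGap, hy, hz, hle, hpow, Real.zero_rpow hp.ne',
          abs_of_pos (gap_pos hx n), -Metric.mem_ball]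
  have hsum (w : M) : ∑ n ∈ s, ballGap w n ≤ (1 - ((2 : ℝ) ^ p)⁻¹)⁻¹ * dist y z ^ p := by
    rw [← Finset.sum_filter]
    exact sum_gap_rpow_le hdy hx hp hyz _ (fun n hn => (Finset.mem_filter.1 hn).2.1)
      fun n hn => (Finset.mem_filter.1 hn).2.2
  calc ∑ n ∈ s, |bump x n y - bump x n z| ^ p
      ≤ ∑ n ∈ s, (ballGap y n + ballGap z n) := Finset.sum_le_sum fun n _ => hterm n
    _ = ∑ n ∈ s, ballGap y n + ∑ n ∈ s, ballGap z n := Finset.sum_add_distrib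
    _ ≤ _ := by rw [two_mul, add_mul]; exact add_le_add (hsum y) (hsum z)

end Dyadic
end NearestNeighborTree

/-- The least power of `2` that is at least `t`; the value at `t ≤ 0` is `0`. -/
noncomputable def dyadicCeil (t : ℝ) : ℝ := if 0 < t then (2 : ℝ) ^ Int.clog 2 t else 0

theorem dyadicCeil_of_pos {t : ℝ} (ht : 0 < t) : dyadicCeil t = (2 : ℝ) ^ Int.clog 2 t :=
  if_pos ht

theorem dyadicCeil_zero : dyadicCeil 0 = 0 := if_neg (lt_irrefl _)

theorem le_dyadicCeil (t : ℝ) : t ≤ dyadicCeil t := by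
  rcases le_or_gt t 0 with ht | ht
  · exact ht.trans_eq (if_neg ht.not_gt).symm
  · rw [dyadicCeil_of_pos ht]
    exact_mod_cast Int.self_le_zpow_clog one_lt_two t

theorem monotone_dyadicCeil : Monotone dyadicCeil := by
  intro s t hst
  by_cases hs : 0 < s
  · rw [dyadicCeil_of_pos hs, dyadicCeil_of_pos (hs.trans_le hst)]
    exact zpow_le_zpow_right₀ one_le_two (Int.clog_mono_right hs hst)
  · rw [dyadicCeil, if_neg hs, dyadicCeil]
    split_ifs <;> positivity

theorem dyadicCeil_le {t : ℝ} (ht : 0 ≤ t) : dyadicCeil t ≤ 2 * t := by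
  rcases ht.eq_or_lt with rfl | ht
  · simp [dyadicCeil_zero]
  · have h := Int.zpow_pred_clog_lt_self (b := 2) one_lt_two ht
    push_cast at h
    rw [zpow_sub_one₀ two_ne_zero] at h
    rw [dyadicCeil_of_pos ht]
    linarith

/-- The space `M` with its distances rounded up to powers of `2`. Rounding is monotone and fixes
`0`, so that it turns an ultrametric into an ultrametric. -/
def DyadicUltrametric (M : Type*) : Type _ := M

namespace DyadicUltrametric

variable {M : Type*} [MetricSpace M]

theorem dyadicCeil_dist_le_max [IsUltrametricDist M] (x y z : M) :
    dyadicCeil (dist x z) ≤ max (dyadicCeil (dist x y)) (dyadicCeil (dist y z)) :=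
  (monotone_dyadicCeil (dist_triangle_max x y z)).trans_eq monotone_dyadicCeil.map_max

variable [IsUltrametricDist M]

noncomputable instance : MetricSpace (DyadicUltrametric M) where
  dist x y := dyadicCeil (dist (α := M) x y)
  dist_self x := (congrArg dyadicCeil (dist_self (α := M) x)).trans dyadicCeil_zero
  dist_comm x y := congrArg dyadicCeil (dist_comm (α := M) x y)
  dist_triangle x y z := (dyadicCeil_dist_le_max (M := M) x y z).trans <|
    max_le_add_of_nonneg (dist_nonneg.trans (le_dyadicCeil _)) (dist_nonneg.trans (le_dyadicCeil _))
  eq_of_dist_eq_zero {x y} h :=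
    (dist_le_zero (γ := M)).1 ((le_dyadicCeil _).trans h.le)

instance : IsUltrametricDist (DyadicUltrametric M) :=
  ⟨dyadicCeil_dist_le_max (M := M)⟩

instance [Infinite M] : Infinite (DyadicUltrametric M) := ‹Infinite M›

instance [TopologicalSpace.SeparableSpace M] :
    TopologicalSpace.SeparableSpace (DyadicUltrametric M) := by
  let toDyadic : M → DyadicUltrametric M := fun y => y
  have hlip : LipschitzWith 2 toDyadic :=
    LipschitzWith.of_dist_le_mul fun y z => dyadicCeil_le (dist_nonneg (x := y) (y := z))
  have hsurj : Function.Surjective toDyadic := fun y => ⟨y, rfl⟩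
  exact hsurj.denseRange.separableSpace hlip.continuous

theorem exists_dist_eq_zpow (y z : DyadicUltrametric M) (h : y ≠ z) :
    ∃ k : ℤ, dist y z = 2 ^ k :=
  ⟨_, dyadicCeil_of_pos ((dist_pos (γ := M)).2 h)⟩

end DyadicUltrametric

namespace NearestNeighborTree

variable {M : Type*} [MetricSpace M] {x : ℕ → M} {p : Set.Ioc (0 : ℝ) 1} {ρ : M → M → ℝ}

/-- The function `bump x n` as an element of the space on which the free space is built. -/
noncomputable def bumpR0 (x : ℕ → M) (n : ℕ) : LipFree.R0 (x 0) := ⟨bump x n, bump_zero x n⟩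

/-- The molecule `(δ(x (n + 1)) - δ(x (parent x n))) / gap x n` of an edge of the tree. -/
noncomputable def molecule (p : Set.Ioc (0 : ℝ) 1) (ρ : M → M → ℝ) (x : ℕ → M) (n : ℕ) :
    LipFree.PSpan p ρ (x 0) :=
  (gap x n)⁻¹ • (LipFree.PSpan.delta p ρ (x 0) (x (n + 1)) -
    LipFree.PSpan.delta p ρ (x 0) (x (parent x n)))

theorem norm_molecule_le (hx : Function.Injective x) (hρ : ∀ y z, 0 ≤ ρ y z) {A : ℝ}
    (hA : ∀ y z, ρ y z ≤ A * dist y z) (n : ℕ) : ‖molecule p ρ x n‖ ≤ A ^ (p : ℝ) := by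
  have hp := p.2.1
  have hgap := gap_pos hx n
  have hbound : (gap x n)⁻¹ * ρ (x (n + 1)) (x (parent x n)) ≤ A := by
    rw [inv_mul_le_iff₀ hgap, mul_comm]
    exact hA _ _
  calc ‖molecule p ρ x n‖
      ≤ (gap x n)⁻¹ ^ (p : ℝ) * ρ (x (n + 1)) (x (parent x n)) ^ (p : ℝ) := by
        rw [molecule, LipFree.norm_smul_eq, Real.norm_of_nonneg (inv_pos.2 hgap).le]
        gcongr
        exact LipFree.norm_delta_sub_le (hρ _ _)
    _ = ((gap x n)⁻¹ * ρ (x (n + 1)) (x (parent x n))) ^ (p : ℝ) :=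
        (Real.mul_rpow (by positivity) (hρ _ _)).symm
    _ ≤ A ^ (p : ℝ) :=
        Real.rpow_le_rpow (mul_nonneg (by positivity) (hρ _ _)) hbound hp.le

theorem delta_mem_span_molecule (hx : Function.Injective x) (n : ℕ) :
    LipFree.PSpan.delta p ρ (x 0) (x n) ∈ Submodule.span ℝ (Set.range (molecule p ρ x)) := by
  induction n using Nat.strong_induction_on with
  | _ n ih =>
    rcases n with _ | n
    · rw [LipFree.PSpan.delta_base]
      exact Submodule.zero_mem _
    · have hstep : LipFree.PSpan.delta p ρ (x 0) (x (n + 1)) =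
          gap x n • molecule p ρ x n + LipFree.PSpan.delta p ρ (x 0) (x (parent x n)) := by
        rw [molecule, smul_inv_smul₀ (gap_pos hx n).ne', sub_add_cancel]
      rw [hstep]
      exact Submodule.add_mem _ (Submodule.smul_mem _ _ (Submodule.subset_span ⟨n, rfl⟩))
        (ih _ (Nat.lt_succ_of_le (parent_le x n)))

theorem dense_span_molecule (hx : Function.Injective x) (hdense : DenseRange x)
    (hδ : Continuous (LipFree.PSpan.delta p ρ (x 0))) :
    Dense (Submodule.span ℝ (Set.range (molecule p ρ x)) : Set (LipFree.PSpan p ρ (x 0))) := by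
  rw [Submodule.dense_iff_topologicalClosure_eq_top, eq_top_iff,
    ← LipFree.PSpan.span_range_delta, Submodule.span_le]
  rintro _ ⟨y, rfl⟩
  refine hdense.induction_on y ((Submodule.isClosed_topologicalClosure _).preimage hδ) fun n => ?_
  exact Submodule.le_topologicalClosure _ (delta_mem_span_molecule hx n)

variable [IsUltrametricDist M]

theorem eval_bumpR0_molecule (hx : Function.Injective x) (j n : ℕ) :
    LipFree.PSpan.eval (bumpR0 x n) (molecule p ρ x j) = if j = n then 1 else 0 := by
  rw [molecule, map_smul, map_sub, LipFree.PSpan.eval_delta, LipFree.PSpan.eval_delta]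
  change (gap x j)⁻¹ * (bump x n (x (j + 1)) - bump x n (x (parent x j))) = _
  rw [bump_succ_sub_bump_parent hx]
  split_ifs with h
  · rw [h, inv_mul_cancel₀ (gap_pos hx n).ne']
  · exact mul_zero _

theorem sum_eval_bumpR0_le (hdy : ∀ y z : M, y ≠ z → ∃ k : ℤ, dist y z = 2 ^ k)
    (hx : Function.Injective x) (hρ : ∀ y z, 0 ≤ ρ y z) {B : ℝ} (hB : 0 < B)
    (hBρ : ∀ y z, dist y z ≤ B * ρ y z) (μ : LipFree.PSpan p ρ (x 0)) (s : Finset ℕ) :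
    ∑ n ∈ s, ‖LipFree.PSpan.eval (bumpR0 x n) μ‖ ^ (p : ℝ) ≤
      2 * (1 - ((2 : ℝ) ^ (p : ℝ))⁻¹)⁻¹ * B ^ (p : ℝ) * ‖μ‖ := by
  have hp := p.2.1
  have hC : 0 < (1 - ((2 : ℝ) ^ (p : ℝ))⁻¹)⁻¹ :=
    inv_pos.2 (sub_pos.2 (inv_lt_one_of_one_lt₀ (Real.one_lt_rpow one_lt_two hp)))
  refine LipFree.sum_eval_rpow_le (bumpR0 x) s (by positivity) hρ (fun y z => ?_) μ
  calc ∑ n ∈ s, |bump x n y - bump x n z| ^ (p : ℝ)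
      ≤ 2 * (1 - ((2 : ℝ) ^ (p : ℝ))⁻¹)⁻¹ * dist y z ^ (p : ℝ) :=
        sum_bump_sub_rpow_le hdy hx hp s y z
    _ ≤ 2 * (1 - ((2 : ℝ) ^ (p : ℝ))⁻¹)⁻¹ * (B * ρ y z) ^ (p : ℝ) := by
        gcongr
        exact hBρ y z
    _ = 2 * (1 - ((2 : ℝ) ^ (p : ℝ))⁻¹)⁻¹ * B ^ (p : ℝ) * ρ y z ^ (p : ℝ) := by
        rw [Real.mul_rpow hB.le (hρ y z)]
        ring

theorem exists_isLpBiorthogonal_molecule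
    (hdy : ∀ y z : M, y ≠ z → ∃ k : ℤ, dist y z = 2 ^ k) (hx : Function.Injective x)
    {A B : ℝ} (hA : ∀ y z, ρ y z ≤ A * dist y z) (hB : 0 < B)
    (hBρ : ∀ y z, dist y z ≤ B * ρ y z) :
    ∃ K, ∃ φ : ℕ → LipFree.PSpan p ρ (x 0) →L[ℝ] ℝ,
      IsLpBiorthogonal p K (molecule p ρ x) φ := by
  have hp := p.2.1
  have hρ (y z : M) : 0 ≤ ρ y z := nonneg_of_mul_nonneg_right (dist_nonneg.trans (hBρ y z)) hB
  set K₀ := 2 * (1 - ((2 : ℝ) ^ (p : ℝ))⁻¹)⁻¹ * B ^ (p : ℝ)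
  have hsum := sum_eval_bumpR0_le (p := p) hdy hx hρ hB hBρ
  let φ (n : ℕ) : LipFree.PSpan p ρ (x 0) →L[ℝ] ℝ := ⟨LipFree.PSpan.eval (bumpR0 x n),
    continuous_of_norm_rpow_le hp _ fun μ => by simpa using hsum μ {n}⟩
  refine ⟨max (A ^ (p : ℝ)) K₀, φ, fun n t => ?_, fun n => ?_, fun hne => ?_, fun μ s => ?_⟩
  · rw [LipFree.norm_smul_eq, mul_comm]
    gcongr
    exact (norm_molecule_le hx hρ hA n).trans (le_max_left _ _)
  · exact (eval_bumpR0_molecule hx n n).trans (if_pos rfl)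
  · exact (eval_bumpR0_molecule hx _ _).trans (if_neg hne)
  · refine (hsum μ s).trans ?_
    gcongr
    exact le_max_right _ _

end NearestNeighborTree

theorem exists_injective_denseRange {M : Type*} [TopologicalSpace M] [T1Space M]
    [TopologicalSpace.SeparableSpace M] [Infinite M] (o : M) :
    ∃ x : ℕ → M, x 0 = o ∧ Function.Injective x ∧ DenseRange x := by
  obtain ⟨S, hScount, hSdense⟩ := TopologicalSpace.exists_countable_dense M
  have hSinf : S.Infinite := fun hfin =>
    Set.infinite_univ (hfin.isClosed.closure_eq.symm.trans hSdense.closure_eq ▸ hfin)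
  have : Countable ↥(insert o S) := (hScount.insert o).to_subtype
  have : Infinite ↥(insert o S) := (hSinf.mono (Set.subset_insert o S)).to_subtype
  obtain ⟨e⟩ : Nonempty (ℕ ≃ ↥(insert o S)) := nonempty_equiv_of_countable
  let x := (Equiv.swap 0 (e.symm ⟨o, Set.mem_insert o S⟩)).trans e
  refine ⟨fun n => x n, by simp [x], Subtype.val_injective.comp x.injective, ?_⟩
  exact hSdense.mono fun y hy => ⟨x.symm ⟨y, Set.mem_insert_of_mem o hy⟩, by simp⟩

section Main

open TopologicalSpace

variable {M : Type*} [MetricSpace M] {p : Set.Ioc (0 : ℝ) 1} {ρ : M → M → ℝ} {A B : ℝ}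

theorem LipFree.continuous_delta {o : M} (hρ : ∀ y z, 0 ≤ ρ y z)
    (hA : ∀ y z, ρ y z ≤ A * dist y z) : Continuous (LipFree.PSpan.delta p ρ o) := by
  have hp := p.2.1
  refine continuous_iff_continuousAt.2 fun y => tendsto_iff_norm_sub_tendsto_zero.2 ?_
  refine squeeze_zero (g := fun z => (A * dist z y) ^ (p : ℝ)) (fun z => norm_nonneg _)
    (fun z => (norm_delta_sub_le (hρ z y)).trans ?_) ?_
  · exact Real.rpow_le_rpow (hρ z y) (hA z y) hp.le
  · have hcont : Continuous fun z => (A * dist z y) ^ (p : ℝ) :=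
      (continuous_const.mul (continuous_id.dist continuous_const)).rpow_const
        fun _ => Or.inr hp.le
    simpa [Real.zero_rpow hp.ne'] using hcont.tendsto y

variable [IsUltrametricDist M] [SeparableSpace M] [Infinite M] (o : M)

theorem quasiNormIsomorphic_lp_of_dyadic (hdy : ∀ y z : M, y ≠ z → ∃ k : ℤ, dist y z = 2 ^ k)
    (hA : ∀ y z, ρ y z ≤ A * dist y z) (hB : 0 < B) (hBρ : ∀ y z, dist y z ≤ B * ρ y z) :
    QuasiNormIsomorphic (LipschitzFree.pnorm : LipschitzFree p ρ o → ℝ)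
      (fun a : lp (fun _ : ℕ => ℝ) (ENNReal.ofReal p) => ‖a‖) := by
  have hp := p.2.1
  have hρ (y z : M) : 0 ≤ ρ y z := nonneg_of_mul_nonneg_right (dist_nonneg.trans (hBρ y z)) hB
  have hexp : (ENNReal.ofReal p).toReal = p := ENNReal.toReal_ofReal hp.le
  obtain ⟨x, rfl, hx, hdense⟩ := exists_injective_denseRange o
  obtain ⟨K, φ, h⟩ :=
    NearestNeighborTree.exists_isLpBiorthogonal_molecule (p := p) hdy hx hA hB hBρ
  have hspan := NearestNeighborTree.dense_span_molecule hx hdense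
    (LipFree.continuous_delta (p := p) hρ hA)
  have hiso := (hexp.symm ▸ h.completion hp.le).quasiNormIsomorphic (hexp.symm ▸ hp)
    (dense_span_range_coe hspan)
  rwa [hexp] at hiso

theorem theorem5p1_general (hA : ∀ y z, ρ y z ≤ A * dist y z) (hB : 0 < B)
    (hBρ : ∀ y z, dist y z ≤ B * ρ y z) :
    QuasiNormIsomorphic (LipschitzFree.pnorm : LipschitzFree p ρ o → ℝ)
      (fun a : lp (fun _ : ℕ => ℝ) (ENNReal.ofReal p) => ‖a‖) := by
  have hA' (y z : M) : ρ y z ≤ |A| * dyadicCeil (dist y z) :=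
    (hA y z).trans (mul_le_mul (le_abs_self A) (le_dyadicCeil _) dist_nonneg (abs_nonneg A))
  have hB' (y z : M) : dyadicCeil (dist y z) ≤ 2 * B * ρ y z := by
    linarith [dyadicCeil_le (dist_nonneg (x := y) (y := z)), hBρ y z]
  exact quasiNormIsomorphic_lp_of_dyadic (M := DyadicUltrametric M) o
    DyadicUltrametric.exists_dist_eq_zpow hA' (by positivity) hB'

end Main

/-- The Lipschitz free `p`-space over an infinite separable pointed ultrametric space is
isomorphic to `ℓ_p` for every `0 < p ≤ 1`. -/
theorem theorem5p1 {M : Type*} [MetricSpace M] [IsUltrametricDist M]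
    [TopologicalSpace.SeparableSpace M] [Infinite M] (o : M) (p : ℝ) (hp : p ∈ Set.Ioc (0 : ℝ) 1) :
    QuasiNormIsomorphic
      (LipschitzFree.pnorm : LipschitzFree ⟨p, hp⟩ (dist : M → M → ℝ) o → ℝ)
      (fun x : lp (fun _ : ℕ => ℝ) (ENNReal.ofReal p) => ‖x‖) := by
  exact theorem5p1_general o (p := ⟨p, hp⟩) (A := 1) (B := 1) (fun y z => (one_mul _).ge)
    one_pos fun y z => (one_mul _).ge
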